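/- Let $n\ge 2$ be an integer, let $\mathbb{B}_n=\{x\in\mathbb{R}^n : |x|<1\}$ be the open Euclidean unit ball, and let $f:\mathbb{B}_n\to(0,\infty)$ be a harmonic function. Then $$d_{\mathbb{R}^+}(f(x),f(y))\le (n-1)\,d_{\mathbb{B}_n}(x,y)\qquad\text{for all } x,y\in\mathbb{B}_n,$$ where $d_{\mathbb{R}^+}(s,t)=\left|\log\frac{s}{t}\right|$ for $s,t>0$ is the hyperbolic metric on $\mathbb{R}^+=(0,\infty)$, and $d_{\mathbb{B}_n}(x,y)=2\tanh^{-1}(|\varphi_y(x)|)$ is the hyperbolic metric on $\mathbb{B}_n$. Here, for $a\in\mathbb{B}_n$, $\varphi_a$ is the Möbius transformation of $\mathbb{B}_n$ given by $$\varphi_a(x)=\frac{(1-|a|^2)(a-x)+|a-x|^2a}{[x,a]^2},\qquad [x,a]=\sqrt{1+|a|^2|x|^2-2\langle a,x\rangle},\qquad x\in\mathbb{B}_n.$$ -/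

import Mathlib

noncomputable section

/-- The bracket `[x, a] = √(1 + |a|² |x|² - 2 ⟨a, x⟩)` on `ℝⁿ`. -/
def ballBracket {n : ℕ} (x a : EuclideanSpace ℝ (Fin n)) : ℝ :=
  Real.sqrt (1 + ‖a‖ ^ 2 * ‖x‖ ^ 2 - 2 * inner ℝ a x)

/-- The Möbius transformation `φ_a` of the open unit ball of `ℝⁿ`:
`φ_a(x) = ((1 - |a|²)(a - x) + |a - x|² a) / [x, a]²`. -/
def ballMobius {n : ℕ} (a x : EuclideanSpace ℝ (Fin n)) : EuclideanSpace ℝ (Fin n) :=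
  (ballBracket x a ^ 2)⁻¹ • ((1 - ‖a‖ ^ 2) • (a - x) + ‖a - x‖ ^ 2 • a)

/-- The hyperbolic metric on the open unit ball of `ℝⁿ`: `d(x, y) = 2 artanh |φ_y(x)|`. -/
def ballHypDist {n : ℕ} (x y : EuclideanSpace ℝ (Fin n)) : ℝ :=
  2 * Real.artanh ‖ballMobius y x‖

/-- The hyperbolic metric on `ℝ⁺ = (0, ∞)`: `d(s, t) = |log (s / t)|`. -/
def posHypDist (s t : ℝ) : ℝ :=
  |Real.log (s / t)|

end

/-! Everything rests on the growth of the Poisson kernel, reached without the Poisson integral.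
Comparing volume means over a ball about `x` with those over the unit ball gives `f x * (1 - ‖x‖) ^
n ≤ f 0`. This exponent is not optimal, but at first order at the origin nothing is lost: the
directional derivatives of `f` at `0` are at most `n * f 0`, the value attained by the Poisson
kernel.

The Kelvin transform in a sphere orthogonal to the unit sphere preserves positive harmonic functions
on the ball and moves any point to the origin. It carries the bound at `0` to a sharp radial
differential inequality at `t • e` (`one_sub_sq_mul_radial_deriv_le`), whose integral is the Harnack
inequality `f x / f 0 ≤ (1 + |x|) / (1 - |x|) ^ (n - 1)`.

A second Kelvin transform, exchanging `0` and `y`, replaces `|x|` by `ρ = |x - y| / [x, y] =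
|φ_y(x)|` at the cost of a factor `q ^ (n - 2)`, where `q = (1 - |y|²) / [x, y] ≤ 1 + ρ`. Hence `f x
/ f y ≤ ((1 + ρ) / (1 - ρ)) ^ (n - 1)`, and the logarithm of the right side is `(n - 1) * 2 artanh
ρ`. -/

section

open InnerProductSpace MeasureTheory Laplacian Topology

/-! ### Mean value property for radial weights -/

section MeanValue

variable {E : Type*} [NormedAddCommGroup E] [InnerProductSpace ℝ E] [FiniteDimensional ℝ E]

theorem laplacian_eq_sum_fderiv_fderiv {ι : Type*} [Fintype ι] (b : OrthonormalBasis ι ℝ E)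
    (f : E → ℝ) (x : E) : Δ f x = ∑ i, fderiv ℝ (fderiv ℝ f) x (b i) (b i) := by
  rw [laplacian_eq_iteratedFDeriv_orthonormalBasis f b]
  simp [iteratedFDeriv_two_apply]

theorem hasCompactSupport_of_eq_zero_of_norm_sq {θ : ℝ → ℝ} {c : ℝ}
    (h : ∀ s, c ≤ s → θ s = 0) : HasCompactSupport fun z : E => θ (‖z‖ ^ 2) := by
  refine HasCompactSupport.intro (isCompact_closedBall (0 : E) (Real.sqrt c)) fun z hz => h _ ?_
  simp only [Metric.mem_closedBall, dist_zero_right, not_le] at hz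
  exact (Real.sqrt_le_left (norm_nonneg z)).1 hz.le

variable [MeasurableSpace E] [BorelSpace E]

/-- Integrating the radial derivative of dilates of a harmonic function against a radial weight
gives zero. -/
theorem integral_radial_mul_fderiv_smul_eq_zero {f : E → ℝ} (hf : ContDiff ℝ 2 f)
    {θ : ℝ → ℝ} (hθ : Continuous θ) {c : ℝ} (hθc : ∀ s, c ≤ s → θ s = 0)
    (hΔ : ∀ x : E, ‖x‖ ^ 2 ≤ c → Δ f x = 0) {t : ℝ} (ht : |t| ≤ 1) :
    ∫ z : E, θ (‖z‖ ^ 2) * fderiv ℝ f (t • z) z = 0 := by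
  -- `Q' = -θ` and `Q = 0` beyond `c`, so `Q(|z|²)` has compact support and gradient `-2 θ(|z|²) z`.
  -- Integrating by parts turns the radial derivative into `Q` times a Laplacian.
  set Q : ℝ → ℝ := fun s => -∫ u in c..s, θ u with hQ
  have hQd : ∀ s, HasDerivAt Q (-θ s) s := fun s =>
    (intervalIntegral.integral_hasDerivAt_right (hθ.intervalIntegrable _ _)
      (hθ.stronglyMeasurableAtFilter _ _) hθ.continuousAt).neg
  have hQc : ∀ s, c ≤ s → Q s = 0 := by
    intro s hs
    simp only [hQ, neg_eq_zero]
    rw [intervalIntegral.integral_congr (g := fun _ => (0 : ℝ))]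
    · simp
    · intro u hu
      rw [Set.uIcc_of_le hs] at hu
      exact hθc u hu.1
  have hQcont : Continuous Q := continuous_iff_continuousAt.2 fun s => (hQd s).continuousAt
  have hQs := hasCompactSupport_of_eq_zero_of_norm_sq (E := E) hQc
  have hθs := hasCompactSupport_of_eq_zero_of_norm_sq (E := E) hθc
  have hf1 : Continuous (fderiv ℝ f) := hf.continuous_fderiv (by norm_num)
  have hf1d : Differentiable ℝ (fderiv ℝ f) :=
    (hf.fderiv_right (m := 1) (by norm_num)).differentiable (by norm_num)
  have hf2 : Continuous (fderiv ℝ (fderiv ℝ f)) :=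
    (hf.fderiv_right (m := 1) (by norm_num)).continuous_fderiv (by norm_num)
  let b := stdOrthonormalBasis ℝ E
  have key : ∀ i, ∫ z : E, Q (‖z‖ ^ 2) * (t * fderiv ℝ (fderiv ℝ f) (t • z) (b i) (b i))
      = 2 * ∫ z : E, θ (‖z‖ ^ 2) * (inner ℝ z (b i) * fderiv ℝ f (t • z) (b i)) := by
    intro i
    have hq : ∀ z : E, HasLineDerivAt ℝ (fun z : E => Q (‖z‖ ^ 2))
        (-θ (‖z‖ ^ 2) * (2 * inner ℝ z (b i))) z (b i) := by
      intro z
      have h := (hQd (‖z‖ ^ 2)).comp_hasFDerivAt z (hasStrictFDerivAt_norm_sq z).hasFDerivAt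
      have h2 := h.hasLineDerivAt (b i)
      simpa [Function.comp_def] using h2
    have hg : ∀ z : E, HasLineDerivAt ℝ (fun z : E => fderiv ℝ f (t • z) (b i))
        (t * fderiv ℝ (fderiv ℝ f) (t • z) (b i) (b i)) z (b i) := by
      intro z
      have h1 : HasFDerivAt (fun z : E => t • z) (t • ContinuousLinearMap.id ℝ E) z :=
        (hasFDerivAt_id z).const_smul t
      have h := ((hf1d (t • z)).hasFDerivAt.comp z h1).clm_apply (hasFDerivAt_const (b i) z)
      have h2 := h.hasLineDerivAt (b i)
      simpa using h2
    have hb := integral_bilinear_hasLineDerivAt_right_eq_neg_left_of_integrable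
      (μ := (volume : Measure E)) (B := ContinuousLinearMap.mul ℝ ℝ)
      (f := fun z : E => Q (‖z‖ ^ 2)) (g := fun z : E => fderiv ℝ f (t • z) (b i))
      (f' := fun z => -θ (‖z‖ ^ 2) * (2 * inner ℝ z (b i)))
      (g' := fun z => t * fderiv ℝ (fderiv ℝ f) (t • z) (b i) (b i)) (v := b i)
      ?_ ?_ ?_ (fun z _ => hq z) (fun z _ => hg z)
    · simp only [ContinuousLinearMap.mul_apply'] at hb
      rw [hb, ← integral_neg, ← integral_const_mul]
      refine integral_congr_ae (Filter.Eventually.of_forall fun z => ?_)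
      simp only
      ring
    · simp only [ContinuousLinearMap.mul_apply', neg_mul, mul_assoc]
      refine (Continuous.integrable_of_hasCompactSupport (by fun_prop) ?_).neg
      exact hθs.mul_right
    · simp only [ContinuousLinearMap.mul_apply']
      exact Continuous.integrable_of_hasCompactSupport (by fun_prop) hQs.mul_right
    · simp only [ContinuousLinearMap.mul_apply']
      exact Continuous.integrable_of_hasCompactSupport (by fun_prop) hQs.mul_right
  have hsum := Finset.sum_congr (rfl : Finset.univ = Finset.univ) fun i _ => key i
  rw [← integral_finsetSum, ← Finset.mul_sum, ← integral_finsetSum] at hsum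
  · have h0 : ∀ z : E, ∑ i, Q (‖z‖ ^ 2) * (t * fderiv ℝ (fderiv ℝ f) (t • z) (b i) (b i)) = 0 := by
      intro z
      rw [← Finset.mul_sum, ← Finset.mul_sum, ← laplacian_eq_sum_fderiv_fderiv]
      rcases le_total c (‖z‖ ^ 2) with h | h
      · simp [hQc _ h]
      · rw [hΔ]
        · simp
        · rw [norm_smul, mul_pow, Real.norm_eq_abs]
          have : |t| ^ 2 ≤ 1 := pow_le_one₀ (abs_nonneg t) ht
          nlinarith [sq_nonneg ‖z‖]
    have h1 : ∀ z : E, ∑ i, θ (‖z‖ ^ 2) * (inner ℝ z (b i) * fderiv ℝ f (t • z) (b i))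
        = θ (‖z‖ ^ 2) * fderiv ℝ f (t • z) z := by
      intro z
      rw [← Finset.mul_sum]
      congr 1
      calc _ = fderiv ℝ f (t • z) (∑ i, inner ℝ (b i) z • b i) := by simp [real_inner_comm]
        _ = _ := by rw [b.sum_repr' z]
    simp only [h0, h1, integral_zero] at hsum
    linarith
  · intro i _
    exact Continuous.integrable_of_hasCompactSupport (by fun_prop) hθs.mul_right
  · intro i _
    exact Continuous.integrable_of_hasCompactSupport (by fun_prop) hQs.mul_right

/-- The weighted integral of the dilate `z ↦ f (t • z)` has zero derivative in `t` on `[0, 1]`; the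
two sides are its values at `t = 1` and `t = 0`. -/
theorem integral_radial_mul_eq_of_contDiff {f : E → ℝ} (hf : ContDiff ℝ 2 f)
    {θ : ℝ → ℝ} (hθ : Continuous θ) {c : ℝ} (hθc : ∀ s, c ≤ s → θ s = 0)
    (hΔ : ∀ x : E, ‖x‖ ^ 2 ≤ c → Δ f x = 0) :
    ∫ z : E, θ (‖z‖ ^ 2) * f z = f 0 * ∫ z : E, θ (‖z‖ ^ 2) := by
  have hθs := hasCompactSupport_of_eq_zero_of_norm_sq (E := E) hθc
  have hf1 : Continuous (fderiv ℝ f) := hf.continuous_fderiv (by norm_num)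
  have hf0 : Continuous f := hf.continuous
  have hd : ∀ t ∈ Set.Icc (0 : ℝ) 1, HasDerivAt (fun t : ℝ => ∫ z : E, θ (‖z‖ ^ 2) * f (t • z))
      0 t := by
    intro t ht
    obtain ⟨C, hC⟩ := ((isCompact_closedBall t (1 : ℝ)).prod
      (isCompact_closedBall (0 : E) (Real.sqrt c))).exists_bound_of_continuousOn
      (f := fun p : ℝ × E => θ (‖p.2‖ ^ 2) * fderiv ℝ f (p.1 • p.2) p.2) (by fun_prop)
    have hC0 : ∀ s ∈ Metric.ball t 1, ∀ z : E,
        ‖θ (‖z‖ ^ 2) * fderiv ℝ f (s • z) z‖ ≤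
          (Metric.closedBall (0 : E) (Real.sqrt c)).indicator (fun _ => C) z := by
      intro s hs z
      by_cases hz : z ∈ Metric.closedBall (0 : E) (Real.sqrt c)
      · rw [Set.indicator_of_mem hz]
        exact hC (s, z) ⟨Metric.ball_subset_closedBall hs, hz⟩
      · rw [Set.indicator_of_notMem hz]
        simp only [Metric.mem_closedBall, dist_zero_right, not_le] at hz
        rw [hθc _ ((Real.sqrt_le_left (norm_nonneg z)).1 hz.le)]
        simp
    have h := (hasDerivAt_integral_of_dominated_loc_of_deriv_le (μ := (volume : Measure E))
      (F := fun t z => θ (‖z‖ ^ 2) * f (t • z))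
      (F' := fun t z => θ (‖z‖ ^ 2) * fderiv ℝ f (t • z) z) (x₀ := t)
      (bound := (Metric.closedBall (0 : E) (Real.sqrt c)).indicator (fun _ => C))
      (Metric.ball_mem_nhds t one_pos) ?_ ?_ ?_ ?_ ?_ ?_).2
    · rwa [integral_radial_mul_fderiv_smul_eq_zero hf hθ hθc hΔ
        (abs_le.2 ⟨by linarith [ht.1], ht.2⟩)] at h
    · refine Filter.Eventually.of_forall fun s => Continuous.aestronglyMeasurable (by fun_prop)
    · exact Continuous.integrable_of_hasCompactSupport (by fun_prop) hθs.mul_right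
    · exact Continuous.aestronglyMeasurable (by fun_prop)
    · exact Filter.Eventually.of_forall fun z s hs => hC0 s hs z
    · refine (integrable_indicator_iff measurableSet_closedBall).2 ?_
      exact integrableOn_const measure_closedBall_lt_top.ne
    · refine Filter.Eventually.of_forall fun z s _ => ?_
      have h1 : HasDerivAt (fun s : ℝ => s • z) z s := by
        simpa using (hasDerivAt_id s).smul_const z
      exact (((hf.differentiable (by norm_num)) (s • z)).hasFDerivAt.comp_hasDerivAt s h1).const_mul
        (θ (‖z‖ ^ 2))
  have hconst := constant_of_has_deriv_right_zero (a := (0 : ℝ)) (b := 1)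
    (fun t ht => (hd t ht).continuousAt.continuousWithinAt)
    (fun t ht => (hd t ⟨ht.1, ht.2.le⟩).hasDerivWithinAt) 1 ⟨zero_le_one, le_rfl⟩
  simp only [one_smul, zero_smul] at hconst
  rw [hconst, integral_mul_const, mul_comm]

/-- The mean value property against radial weights. -/
theorem integral_radial_mul_eq {f : E → ℝ} {R : ℝ} (hf : HarmonicOnNhd f (Metric.ball 0 R))
    {θ : ℝ → ℝ} (hθ : Continuous θ) {r : ℝ} (hr0 : 0 < r) (hr : r < R)
    (hθc : ∀ s, r ^ 2 ≤ s → θ s = 0) :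
    ∫ z : E, θ (‖z‖ ^ 2) * f z = f 0 * ∫ z : E, θ (‖z‖ ^ 2) := by
  obtain ⟨r₁, h1, h2⟩ := exists_between hr
  obtain ⟨r₂, h3, h4⟩ := exists_between h2
  -- The cutoff makes `χ * f` globally C² without changing `f` near the closed ball of radius `r`,
  -- outside which the weight vanishes.
  let χ : ContDiffBump (0 : E) := ⟨r₁, r₂, hr0.trans h1, h3⟩
  have hχ : ∀ x : E, ‖x‖ < r₁ → (fun x => χ x * f x) =ᶠ[𝓝 x] f := by
    intro x hx
    filter_upwards [Metric.isOpen_ball.mem_nhds (show x ∈ Metric.ball (0 : E) r₁ by simpa using hx)]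
      with y hy
    rw [χ.one_of_mem_closedBall (Metric.ball_subset_closedBall hy), one_mul]
  have hcd : ContDiff ℝ 2 fun x => χ x * f x := by
    refine contDiff_iff_contDiffAt.2 fun x => ?_
    by_cases hx : x ∈ Metric.ball (0 : E) R
    · exact χ.contDiffAt.mul (hf x hx).1
    · refine (contDiffAt_const (c := (0 : ℝ))).congr_of_eventuallyEq ?_
      have hx' : x ∈ (Metric.closedBall (0 : E) r₂)ᶜ := by
        simp only [Metric.mem_ball, dist_zero_right, not_lt, Set.mem_compl_iff,
          Metric.mem_closedBall, not_le] at hx ⊢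
        linarith
      filter_upwards [Metric.isClosed_closedBall.isOpen_compl.mem_nhds hx'] with y hy
      rw [χ.zero_of_le_dist, zero_mul]
      simp only [Set.mem_compl_iff, Metric.mem_closedBall, not_le] at hy
      exact hy.le
  have h := integral_radial_mul_eq_of_contDiff hcd hθ hθc (fun x hx => by
    have hx' : ‖x‖ < r₁ :=
      (pow_le_pow_iff_left₀ (norm_nonneg x) hr0.le two_ne_zero).1 hx |>.trans_lt h1
    rw [(laplacian_congr_nhds (hχ x hx')).eq_of_nhds]
    exact (hf x (by simpa using hx'.trans h2)).2.eq_of_nhds)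
  rw [(hχ 0 (by simpa using hr0.trans h1)).eq_of_nhds] at h
  rw [← h]
  refine integral_congr_ae (Filter.Eventually.of_forall fun z => ?_)
  rcases le_or_gt (r ^ 2) (‖z‖ ^ 2) with hz | hz
  · simp [hθc _ hz]
  · have hz' : ‖z‖ < r := lt_of_pow_lt_pow_left₀ 2 hr0.le hz
    simp only
    rw [(hχ z (hz'.trans h1)).eq_of_nhds]

end MeanValue

/-! ### A first Harnack inequality from volume means -/

section VolumeHarnack

variable {E : Type*} [NormedAddCommGroup E] [InnerProductSpace ℝ E] [FiniteDimensional ℝ E]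

theorem InnerProductSpace.HarmonicAt.comp_add_right {f : E → ℝ} {x a : E}
    (hf : HarmonicAt f (x + a)) : HarmonicAt (fun z => f (z + a)) x := by
  have hΔ : Δ (fun z => f (z + a)) = fun z => Δ f (z + a) := by
    simp only [laplacian_eq_iteratedFDeriv_stdOrthonormalBasis, iteratedFDeriv_comp_add_right]
  have ht : Filter.Tendsto (fun z : E => z + a) (𝓝 x) (𝓝 (x + a)) :=
    (continuous_add_const a).tendsto x
  refine ⟨hf.1.comp x (contDiffAt_id.add contDiffAt_const), ?_⟩
  rw [hΔ]
  exact ht.eventually hf.2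

/-- The continuous profile which is `1` below `a`, `0` above `b`, and affine in between. -/
noncomputable def rampProfile (a b s : ℝ) : ℝ := max 0 (min 1 ((b - s) / (b - a)))

theorem continuous_rampProfile (a b : ℝ) : Continuous (rampProfile a b) := by
  unfold rampProfile
  fun_prop

theorem rampProfile_nonneg (a b s : ℝ) : 0 ≤ rampProfile a b s := le_max_left _ _

theorem rampProfile_le_one (a b s : ℝ) : rampProfile a b s ≤ 1 :=
  max_le zero_le_one (min_le_left _ _)

theorem rampProfile_eq_one {a b s : ℝ} (hab : a < b) (hs : s ≤ a) : rampProfile a b s = 1 := by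
  have h : 1 ≤ (b - s) / (b - a) := (one_le_div (by linarith)).2 (by linarith)
  rw [rampProfile, min_eq_left h, max_eq_right zero_le_one]

theorem rampProfile_eq_zero {a b s : ℝ} (hab : a < b) (hs : b ≤ s) : rampProfile a b s = 0 := by
  have h : (b - s) / (b - a) ≤ 0 := div_nonpos_of_nonpos_of_nonneg (by linarith) (by linarith)
  exact max_eq_left ((min_le_right _ _).trans h)

variable [MeasurableSpace E] [BorelSpace E]

theorem integrable_radial_mul {f : E → ℝ} {R : ℝ} (hf : ContinuousOn f (Metric.ball 0 R))
    {θ : ℝ → ℝ} (hθ : Continuous θ) {r : ℝ} (hr0 : 0 < r) (hr : r < R)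
    (hθc : ∀ s, r ^ 2 ≤ s → θ s = 0) : Integrable fun z : E => θ (‖z‖ ^ 2) * f z := by
  have h : (fun z : E => θ (‖z‖ ^ 2) * f z) =
      (Metric.closedBall 0 r).indicator fun z : E => θ (‖z‖ ^ 2) * f z := by
    ext z
    by_cases hz : z ∈ Metric.closedBall (0 : E) r
    · rw [Set.indicator_of_mem hz]
    · rw [Set.indicator_of_notMem hz, hθc, zero_mul]
      simp only [Metric.mem_closedBall, dist_zero_right, not_le] at hz
      exact pow_le_pow_left₀ hr0.le hz.le 2
  rw [h, integrable_indicator_iff measurableSet_closedBall]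
  refine ContinuousOn.integrableOn_compact (isCompact_closedBall _ _) ?_
  exact (Continuous.continuousOn (by fun_prop)).mul (hf.mono (Metric.closedBall_subset_ball hr))

theorem pow_mul_volume_le_integral_rampProfile {a b : ℝ} (ha : 0 < a) (hab : a < b) :
    a ^ Module.finrank ℝ E * volume.real (Metric.ball (0 : E) 1) ≤
      ∫ z : E, rampProfile (a ^ 2) (b ^ 2) (‖z‖ ^ 2) := by
  have hab2 : a ^ 2 < b ^ 2 := pow_lt_pow_left₀ hab ha.le two_ne_zero
  rw [← Measure.addHaar_real_closedBall volume (0 : E) ha.le,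
    ← integral_indicator_one measurableSet_closedBall]
  refine integral_mono_of_nonneg (Filter.Eventually.of_forall fun z =>
    Set.indicator_nonneg (fun _ _ => zero_le_one) z) ?_ (Filter.Eventually.of_forall fun z => ?_)
  · have := integrable_radial_mul (E := E) (f := fun _ => 1) (R := b + 1) continuousOn_const
      (continuous_rampProfile (a ^ 2) (b ^ 2)) (ha.trans hab) (by linarith)
      (fun s hs => rampProfile_eq_zero hab2 hs)
    simpa using this
  · by_cases hz : z ∈ Metric.closedBall (0 : E) a
    · simp only [Set.indicator_of_mem hz, Pi.one_apply]
      rw [rampProfile_eq_one hab2 (pow_le_pow_left₀ (norm_nonneg z) (by simpa using hz) 2)]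
    · simpa only [Set.indicator_of_notMem hz] using rampProfile_nonneg _ _ _

theorem integral_rampProfile_le_pow_mul_volume {a b : ℝ} (ha : 0 < a) (hab : a < b) :
    ∫ z : E, rampProfile (a ^ 2) (b ^ 2) (‖z‖ ^ 2) ≤
      b ^ Module.finrank ℝ E * volume.real (Metric.ball (0 : E) 1) := by
  have hb := ha.trans hab
  have hab2 : a ^ 2 < b ^ 2 := pow_lt_pow_left₀ hab ha.le two_ne_zero
  rw [← Measure.addHaar_real_closedBall volume (0 : E) hb.le,
    ← integral_indicator_one measurableSet_closedBall]
  refine integral_mono_of_nonneg (Filter.Eventually.of_forall fun z =>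
    rampProfile_nonneg _ _ _) ?_ (Filter.Eventually.of_forall fun z => ?_)
  · exact (integrable_indicator_iff measurableSet_closedBall).2
      (integrableOn_const measure_closedBall_lt_top.ne)
  · by_cases hz : z ∈ Metric.closedBall (0 : E) b
    · simpa [Set.indicator_of_mem hz] using rampProfile_le_one _ _ _
    · simp only [Metric.mem_closedBall, dist_zero_right, not_le] at hz
      simp only
      rw [rampProfile_eq_zero hab2 (pow_le_pow_left₀ hb.le hz.le 2)]
      exact Set.indicator_nonneg (fun _ _ => zero_le_one) z

/-- Harnack's inequality obtained by comparing volume means over nested balls. -/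
theorem harmonic_mul_one_sub_norm_pow_le {f : E → ℝ} (hf : HarmonicOnNhd f (Metric.ball 0 1))
    (hpos : ∀ x ∈ Metric.ball (0 : E) 1, 0 < f x) {x : E} (hx : x ∈ Metric.ball (0 : E) 1) :
    f x * (1 - ‖x‖) ^ Module.finrank ℝ E ≤ f 0 := by
  have hx1 : ‖x‖ < 1 := by simpa using hx
  have key : ∀ a ∈ Set.Ioo 0 (1 - ‖x‖), f x * a ^ Module.finrank ℝ E ≤ f 0 := by
    rintro a ⟨ha0, ha⟩
    -- Ramps replace indicators of balls to keep the weights continuous. The ramp about `x` is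
    -- supported in radius `b`; the ramp about `0` equals `1` up to `b + ‖x‖`, hence dominates it,
    -- and dies at `c < 1`.
    obtain ⟨b, hab, hb⟩ := exists_between ha
    obtain ⟨c, hbc, hc⟩ := exists_between (show b + ‖x‖ < 1 by linarith)
    have hb0 := ha0.trans hab
    have hbx : 0 < b + ‖x‖ := by positivity
    have hab2 : a ^ 2 < b ^ 2 := pow_lt_pow_left₀ hab ha0.le two_ne_zero
    have hbc2 : (b + ‖x‖) ^ 2 < c ^ 2 := pow_lt_pow_left₀ hbc hbx.le two_ne_zero
    have hshift : HarmonicOnNhd (fun z => f (z + x)) (Metric.ball 0 (1 - ‖x‖)) := by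
      intro z hz
      refine (hf (z + x) ?_).comp_add_right
      simp only [Metric.mem_ball, dist_zero_right] at hz ⊢
      linarith [norm_add_le z x]
    have h1 := integral_radial_mul_eq hshift (continuous_rampProfile (a ^ 2) (b ^ 2)) hb0 hb
      (fun s hs => rampProfile_eq_zero hab2 hs)
    have h2 := integral_radial_mul_eq hf (continuous_rampProfile ((b + ‖x‖) ^ 2) (c ^ 2))
      (hbx.trans hbc) hc (fun s hs => rampProfile_eq_zero hbc2 hs)
    have h3 : ∫ z : E, rampProfile (a ^ 2) (b ^ 2) (‖z‖ ^ 2) * f (z + x) ≤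
        ∫ z : E, rampProfile ((b + ‖x‖) ^ 2) (c ^ 2) (‖z‖ ^ 2) * f z := by
      rw [← integral_add_right_eq_self
        (fun z => rampProfile ((b + ‖x‖) ^ 2) (c ^ 2) (‖z‖ ^ 2) * f z) x]
      refine integral_mono_of_nonneg (Filter.Eventually.of_forall fun z => ?_) ?_
        (Filter.Eventually.of_forall fun z => ?_)
      · rcases le_or_gt b ‖z‖ with h | h
        · simp [rampProfile_eq_zero hab2 (pow_le_pow_left₀ hb0.le h 2)]
        · refine mul_nonneg (rampProfile_nonneg _ _ _) (hpos _ ?_).le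
          simp only [Metric.mem_ball, dist_zero_right]
          linarith [norm_add_le z x]
      · exact (integrable_radial_mul hf.continuousOn (continuous_rampProfile _ _)
          (hbx.trans hbc) hc (fun s hs => rampProfile_eq_zero hbc2 hs)).comp_add_right x
      · rcases le_or_gt b ‖z‖ with h | h
        · simp only
          rw [rampProfile_eq_zero hab2 (pow_le_pow_left₀ hb0.le h 2), zero_mul]
          rcases le_or_gt c ‖z + x‖ with h' | h'
          · rw [rampProfile_eq_zero hbc2 (pow_le_pow_left₀ (hbx.trans hbc).le h' 2), zero_mul]
          · refine mul_nonneg (rampProfile_nonneg _ _ _) (hpos _ ?_).le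
            simpa using h'.trans hc
        · have hzx : ‖z + x‖ ≤ b + ‖x‖ := by linarith [norm_add_le z x]
          simp only
          rw [rampProfile_eq_one hbc2 (pow_le_pow_left₀ (norm_nonneg _) hzx 2)]
          refine mul_le_mul_of_nonneg_right (rampProfile_le_one _ _ _) (hpos _ ?_).le
          simp only [Metric.mem_ball, dist_zero_right]
          linarith
    rw [h1, h2] at h3
    simp only [zero_add] at h3
    have hV : 0 < volume.real (Metric.ball (0 : E) 1) := by
      simpa [Measure.real] using ENNReal.toReal_pos
        (Metric.measure_ball_pos volume (0 : E) one_pos).ne' measure_ball_lt_top.ne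
    have h0 : 0 < f 0 := hpos 0 (by simp)
    have h4 := mul_le_mul_of_nonneg_left (pow_mul_volume_le_integral_rampProfile (E := E) ha0 hab)
      (hpos x hx).le
    have h5 := mul_le_mul_of_nonneg_left
      (integral_rampProfile_le_pow_mul_volume (E := E) hbx hbc) h0.le
    have h6 : c ^ Module.finrank ℝ E ≤ 1 := pow_le_one₀ (hbx.trans hbc).le hc.le
    have h7 := mul_le_mul_of_nonneg_left (mul_le_mul_of_nonneg_right h6 hV.le) h0.le
    refine le_of_mul_le_mul_right ?_ hV
    linarith
  have hlim : Filter.Tendsto (fun a : ℝ => f x * a ^ Module.finrank ℝ E) (𝓝[<] (1 - ‖x‖))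
      (𝓝 (f x * (1 - ‖x‖) ^ Module.finrank ℝ E)) :=
    (Continuous.tendsto (by fun_prop) _).mono_left nhdsWithin_le_nhds
  refine le_of_tendsto hlim ?_
  filter_upwards [Ioo_mem_nhdsLT (show (0 : ℝ) < 1 - ‖x‖ by linarith)] with a ha
  exact key a ha

end VolumeHarnack

/-! ### Harmonicity of the Kelvin transform -/

section Kelvin

variable {E : Type*} [NormedAddCommGroup E] [InnerProductSpace ℝ E]

theorem fderiv_fderiv_apply_eq_of_line {g : E → ℝ} {x e : E} (hg : ContDiffAt ℝ 2 g x)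
    {G : ℝ → ℝ} {c : ℝ} (h1 : ∀ᶠ t in 𝓝 (0 : ℝ), HasDerivAt (fun s : ℝ => g (x + s • e)) (G t) t)
    (h2 : HasDerivAt G c 0) : fderiv ℝ (fderiv ℝ g) x e e = c := by
  have hline : ∀ t : ℝ, HasDerivAt (fun s : ℝ => x + s • e) e t := fun t => by
    simpa using ((hasDerivAt_id t).smul_const e).const_add x
  have hx : x + (0 : ℝ) • e = x := by simp
  have hev : ∀ᶠ t in 𝓝 (0 : ℝ), DifferentiableAt ℝ g (x + t • e) := by
    have hc : Filter.Tendsto (fun s : ℝ => x + s • e) (𝓝 0) (𝓝 x) := by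
      simpa using (hline 0).continuousAt.tendsto
    exact hc.eventually ((hg.eventually (by simp)).mono
      fun y hy => hy.differentiableAt (by norm_num))
  have hG : G =ᶠ[𝓝 0] fun t => fderiv ℝ g (x + t • e) e := by
    filter_upwards [h1, hev] with t ht ht'
    exact ht.unique (ht'.hasFDerivAt.comp_hasDerivAt t (hline t))
  have hd : DifferentiableAt ℝ (fderiv ℝ g) x :=
    (hg.fderiv_right (m := 1) (by norm_num)).differentiableAt (by norm_num)
  have h3 : HasDerivAt (fun t : ℝ => fderiv ℝ g (x + t • e) e) (fderiv ℝ (fderiv ℝ g) x e e) 0 := by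
    have h4 : HasDerivAt (fun t : ℝ => fderiv ℝ g (x + t • e)) (fderiv ℝ (fderiv ℝ g) x e) 0 :=
      hd.hasFDerivAt.comp_hasDerivAt_of_eq (0 : ℝ) (hline 0) hx.symm
    exact (ContinuousLinearMap.apply ℝ ℝ e).hasFDerivAt.comp_hasDerivAt (0 : ℝ) h4
  exact (h3.congr_of_eventuallyEq hG).unique h2

/-- Inversion in the sphere centred at `p` whose squared radius is `k`. -/
noncomputable def sphereInversion (p : E) (k : ℝ) (z : E) : E := p + (k / ‖z - p‖ ^ 2) • (z - p)

/-- The Kelvin transform with respect to the sphere centred at `p` with squared radius `k`, with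
exponent normalised to the dimension `finrank ℝ E`. -/
noncomputable def kelvinTransform (p : E) (k : ℝ) (f : E → ℝ) (z : E) : ℝ :=
  (‖z - p‖ ^ 2) ^ (1 - (Module.finrank ℝ E : ℝ) / 2) * f (sphereInversion p k z)

theorem contDiffAt_sphereInversion {p : E} {k : ℝ} {z : E} (hz : z ≠ p) :
    ContDiffAt ℝ 2 (sphereInversion p k) z := by
  have h : ‖z - p‖ ^ 2 ≠ 0 := pow_ne_zero 2 (norm_ne_zero_iff.2 (sub_ne_zero.2 hz))
  have h1 : ContDiffAt ℝ 2 (fun z : E => z - p) z := contDiffAt_id.sub contDiffAt_const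
  exact contDiffAt_const.add ((contDiffAt_const.div (h1.norm_sq ℝ) h).smul h1)

theorem contDiffAt_kelvinTransform {p : E} {k : ℝ} {f : E → ℝ} {z : E} (hz : z ≠ p)
    (hf : ContDiffAt ℝ 2 f (sphereInversion p k z)) : ContDiffAt ℝ 2 (kelvinTransform p k f) z := by
  have h : ‖z - p‖ ^ 2 ≠ 0 := pow_ne_zero 2 (norm_ne_zero_iff.2 (sub_ne_zero.2 hz))
  have h1 : ContDiffAt ℝ 2 (fun z : E => z - p) z := contDiffAt_id.sub contDiffAt_const
  exact ((h1.norm_sq ℝ).rpow_const_of_ne h).mul (hf.comp z (contDiffAt_sphereInversion hz))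

/-- Two one-variable differentiations along `z + t • e`. Each factor `a = ⟨u, e⟩` stays next to a
derivative in direction `e`, so that summing over an orthonormal basis rebuilds `u`. -/
theorem fderiv_fderiv_kelvinTransform {p : E} {k : ℝ} {f : E → ℝ} {z : E} (hz : z ≠ p)
    (hf : ContDiffAt ℝ 2 f (sphereInversion p k z)) {e : E} (he : ‖e‖ = 1) {c ρ a : ℝ} {u y : E}
    (hc : 1 - (Module.finrank ℝ E : ℝ) / 2 = c) (hu : z - p = u) (hρ : ‖u‖ ^ 2 = ρ)
    (ha : inner ℝ u e = a) (hy : sphereInversion p k z = y) :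
    fderiv ℝ (fderiv ℝ (kelvinTransform p k f)) z e e = ρ ^ c *
      (((4 * c ^ 2 - 4 * c) * a ^ 2 / ρ ^ 2 + 2 * c / ρ) * f y
        + 4 * c * k / ρ ^ 2 * (a * fderiv ℝ f y e)
        + ((8 - 8 * c) * k * a ^ 2 / ρ ^ 3 - 2 * k / ρ ^ 2) * fderiv ℝ f y u
        - 4 * k / ρ ^ 2 * (a * fderiv ℝ f y e)
        + 4 * k ^ 2 * a ^ 2 / ρ ^ 4 * fderiv ℝ (fderiv ℝ f) y u u
        - 2 * k ^ 2 / ρ ^ 3 * (a * fderiv ℝ (fderiv ℝ f) y u e)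
        - 2 * k ^ 2 / ρ ^ 3 * (a * fderiv ℝ (fderiv ℝ f) y e u)
        + k ^ 2 / ρ ^ 2 * fderiv ℝ (fderiv ℝ f) y e e) := by
  have hρ0 : 0 < ρ := by
    rw [← hρ, ← hu]
    exact pow_pos (norm_pos_iff.2 (sub_ne_zero.2 hz)) 2
  -- Along the line, `r` is the squared distance to `p` and `γ` the inverted point.
  set r : ℝ → ℝ := fun t => ρ + 2 * a * t + t ^ 2 with hr
  set γ : ℝ → E := fun t => p + (k / r t) • (u + t • e) with hγ
  set γ' : ℝ → E := fun t =>
    (-(k * (2 * a + 2 * t)) / r t ^ 2) • (u + t • e) + (k / r t) • e with hγ'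
  have hr0 : r 0 = ρ := by simp [hr]
  have hsub : ∀ t : ℝ, z + t • e - p = u + t • e := fun t => by rw [← hu]; abel
  have hnorm : ∀ t : ℝ, ‖z + t • e - p‖ ^ 2 = r t := fun t => by
    rw [hsub, norm_add_sq_real, hρ, inner_smul_right, ha, norm_smul, he, mul_one,
      Real.norm_eq_abs, sq_abs]
    simp only [hr]
    ring
  have hline : ∀ t, kelvinTransform p k f (z + t • e) = r t ^ c * f (γ t) := fun t => by
    rw [kelvinTransform, sphereInversion, hc, hnorm, hsub]
  have hrd : ∀ t, HasDerivAt r (2 * a + 2 * t) t := fun t => by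
    have := (((hasDerivAt_id t).const_mul (2 * a)).const_add ρ).add ((hasDerivAt_id t).pow 2)
    simpa [hr, Pi.add_def] using this
  have hrpos : ∀ᶠ t in 𝓝 (0 : ℝ), 0 < r t :=
    (hrd 0).continuousAt.eventually (lt_mem_nhds (by rwa [hr0]))
  have hlin : ∀ t : ℝ, HasDerivAt (fun s : ℝ => u + s • e) e t := fun t => by
    simpa using ((hasDerivAt_id t).smul_const e).const_add u
  have hγd : ∀ t, r t ≠ 0 → HasDerivAt γ (γ' t) t := fun t ht => by
    have h := ((((hasDerivAt_const t k).div (hrd t) ht).smul (hlin t)).const_add p)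
    refine h.congr_deriv ?_
    simp only [hγ', zero_mul, zero_sub]
    exact add_comm _ _
  have hγ0 : γ 0 = y := by
    rw [← hy, sphereInversion, hu, hρ]
    simp [hγ, hr0]
  have hfγ : ∀ᶠ t in 𝓝 (0 : ℝ), DifferentiableAt ℝ f (γ t) := by
    refine (hγd 0 (by rw [hr0]; exact hρ0.ne')).continuousAt.eventually ?_
    rw [hγ0, ← hy]
    exact (hf.eventually (by simp)).mono fun y hy => hy.differentiableAt (by norm_num)
  have hP : ∀ t, 0 < r t → HasDerivAt (fun t => r t ^ c) (r t ^ c * (c * (2 * a + 2 * t) / r t)) t :=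
    fun t ht => by
      refine ((hrd t).rpow_const (p := c) (Or.inl ht.ne')).congr_deriv ?_
      rw [Real.rpow_sub_one ht.ne']
      ring
  rw [hy] at hf
  have hfd : DifferentiableAt ℝ (fderiv ℝ f) (γ 0) := by
    rw [hγ0]
    exact (hf.fderiv_right (m := 1) (by norm_num)).differentiableAt (by norm_num)
  refine fderiv_fderiv_apply_eq_of_line (contDiffAt_kelvinTransform hz (by rwa [hy]))
    (G := fun t => r t ^ c * (c * (2 * a + 2 * t) / r t * f (γ t) + fderiv ℝ f (γ t) (γ' t))) ?_ ?_
  · filter_upwards [hrpos, hfγ] with t ht htf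
    simp only [hline]
    refine ((hP t ht).mul (htf.hasFDerivAt.comp_hasDerivAt t (hγd t ht.ne'))).congr_deriv ?_
    simp only [Function.comp_apply]
    ring
  · have hρr : r 0 ≠ 0 := by rw [hr0]; exact hρ0.ne'
    have hr'd : HasDerivAt (fun t : ℝ => 2 * a + 2 * t) 2 0 := by
      simpa using ((hasDerivAt_id (0 : ℝ)).const_mul 2).const_add (2 * a)
    have hγ'd := ((((hr'd.const_mul k).neg).div ((hrd 0).pow 2) (pow_ne_zero 2 hρr)).smul
      (hlin 0)).add (((hasDerivAt_const (0 : ℝ) k).div (hrd 0) hρr).smul_const e)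
    have hfγ0 := hfγ.self_of_nhds.hasFDerivAt.comp_hasDerivAt (0 : ℝ) (hγd 0 hρr)
    have hDf := (hfd.hasFDerivAt.comp_hasDerivAt (0 : ℝ) (hγd 0 hρr)).clm_apply hγ'd
    have hG := (hP 0 (by rwa [hr0])).mul
      ((((hr'd.const_mul c).div (hrd 0) hρr).mul hfγ0).add hDf)
    refine hG.congr_deriv ?_
    simp only [hγ', Function.comp_apply, Pi.add_apply, Pi.mul_apply, Pi.div_apply, Pi.neg_apply,
      Pi.smul_apply', Pi.pow_apply, hr0, hγ0, map_add, map_smul, add_apply, smul_apply,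
      smul_eq_mul, zero_smul, add_zero, mul_zero]
    field_simp
    ring

variable [FiniteDimensional ℝ E]

/-- After summation over a basis, the coefficients of `f y` and of its derivative along `u` vanish
because the dimension is `2 - 2 * c`. The second derivatives along `u` cancel in any dimension,
leaving a multiple of `Δ f y`. -/
theorem laplacian_kelvinTransform {p : E} {k : ℝ} {f : E → ℝ} {z : E} (hz : z ≠ p)
    (hf : ContDiffAt ℝ 2 f (sphereInversion p k z)) (hΔ : Δ f (sphereInversion p k z) = 0) :
    Δ (kelvinTransform p k f) z = 0 := by
  let b := stdOrthonormalBasis ℝ E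
  set u := z - p with hu
  set y := sphereInversion p k z with hy
  set c := 1 - (Module.finrank ℝ E : ℝ) / 2 with hc
  set ρ := ‖u‖ ^ 2 with hρ
  have hρ0 : 0 < ρ := pow_pos (norm_pos_iff.2 (sub_ne_zero.2 hz)) 2
  have hsum : ∑ i, inner ℝ u (b i) • b i = u := by
    simpa [real_inner_comm] using b.sum_repr' u
  have h0 : ∑ i, inner ℝ u (b i) ^ 2 = ρ := by
    rw [hρ, ← b.sum_sq_norm_inner_left u]
    simp
  have h1 : ∑ i, inner ℝ u (b i) * fderiv ℝ f y (b i) = fderiv ℝ f y u := by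
    conv_rhs => rw [← hsum]
    simp
  have h2 : ∑ i, inner ℝ u (b i) * fderiv ℝ (fderiv ℝ f) y u (b i) =
      fderiv ℝ (fderiv ℝ f) y u u := by
    calc _ = fderiv ℝ (fderiv ℝ f) y u (∑ i, inner ℝ u (b i) • b i) := by simp
      _ = _ := by rw [hsum]
  have h3 : ∑ i, inner ℝ u (b i) * fderiv ℝ (fderiv ℝ f) y (b i) u =
      fderiv ℝ (fderiv ℝ f) y u u := by
    calc _ = fderiv ℝ (fderiv ℝ f) y (∑ i, inner ℝ u (b i) • b i) u := by simp
      _ = _ := by rw [hsum]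
  rw [laplacian_eq_sum_fderiv_fderiv b] at hΔ ⊢
  have hi : ∀ i, _ := fun i => fderiv_fderiv_kelvinTransform hz hf (b.norm_eq_one i) hc.symm hu.symm
    hρ.symm rfl hy.symm
  simp only [hi]
  rw [← Finset.mul_sum]
  simp only [Finset.sum_add_distrib, Finset.sum_sub_distrib, ← Finset.mul_sum, ← Finset.sum_mul,
    ← Finset.sum_div, h0, h1, h2, h3, hΔ, Finset.sum_const, Finset.card_univ, Fintype.card_fin,
    nsmul_eq_mul]
  have hn : (Module.finrank ℝ E : ℝ) = 2 - 2 * c := by rw [hc]; ring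
  rw [hn]
  field_simp
  ring

theorem InnerProductSpace.HarmonicAt.kelvinTransform {p : E} {k : ℝ} {f : E → ℝ} {z : E}
    (hz : z ≠ p) (hf : HarmonicAt f (sphereInversion p k z)) :
    HarmonicAt (kelvinTransform p k f) z := by
  refine ⟨contDiffAt_kelvinTransform hz hf.1, ?_⟩
  filter_upwards [(contDiffAt_sphereInversion (k := k) hz).continuousAt.eventually hf.eventually,
    isOpen_ne.mem_nhds hz] with w hw hwp
  exact laplacian_kelvinTransform hwp hw.1 hw.2.eq_of_nhds

end Kelvin

/-! ### Sharp Harnack inequalities on the ball -/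

section BallHarnack

theorem ne_of_mem_ball_of_one_lt_norm {E : Type*} [NormedAddCommGroup E] {p z : E}
    (hp : 1 < ‖p‖) (hz : z ∈ Metric.ball (0 : E) 1) : z ≠ p := by
  rintro rfl
  simp only [Metric.mem_ball, dist_zero_right] at hz
  linarith

variable {E : Type*} [NormedAddCommGroup E] [InnerProductSpace ℝ E]

/-- Squared radius `‖p‖ ^ 2 - 1` makes the sphere orthogonal to the unit sphere; the positive factor
shows that inversion preserves the ball when `1 < ‖p‖`. -/
theorem one_sub_norm_sphereInversion_sq {p z : E} (hz : z ≠ p) :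
    1 - ‖sphereInversion p (‖p‖ ^ 2 - 1) z‖ ^ 2 =
      (‖p‖ ^ 2 - 1) / ‖z - p‖ ^ 2 * (1 - ‖z‖ ^ 2) := by
  have h : ‖z - p‖ ≠ 0 := norm_ne_zero_iff.2 (sub_ne_zero.2 hz)
  have h1 : ‖z‖ ^ 2 = ‖p‖ ^ 2 + 2 * inner ℝ p (z - p) + ‖z - p‖ ^ 2 := by
    rw [← norm_add_sq_real, add_sub_cancel]
  rw [sphereInversion, norm_add_sq_real, inner_smul_right, norm_smul, mul_pow, Real.norm_eq_abs,
    sq_abs, h1]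
  field_simp
  ring

theorem norm_sphereInversion_sub_sq {p z : E} {k : ℝ} :
    ‖sphereInversion p k z - p‖ ^ 2 = k ^ 2 / ‖z - p‖ ^ 2 := by
  rw [sphereInversion, add_sub_cancel_left, norm_smul, mul_pow, Real.norm_eq_abs, sq_abs]
  rcases eq_or_ne (‖z - p‖) 0 with h | h
  · simp [h]
  · field_simp

theorem sphereInversion_sphereInversion {p z : E} {k : ℝ} (hk : k ≠ 0) (hz : z ≠ p) :
    sphereInversion p k (sphereInversion p k z) = z := by
  have h : ‖z - p‖ ≠ 0 := norm_ne_zero_iff.2 (sub_ne_zero.2 hz)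
  have h1 : k / (k ^ 2 / ‖z - p‖ ^ 2) * (k / ‖z - p‖ ^ 2) = 1 := by field_simp
  conv_lhs => rw [sphereInversion]
  rw [norm_sphereInversion_sub_sq, sphereInversion, add_sub_cancel_left, smul_smul, h1, one_smul,
    add_sub_cancel]

theorem sphereInversion_mem_ball {p z : E} (hp : 1 < ‖p‖) (hz : z ∈ Metric.ball (0 : E) 1) :
    sphereInversion p (‖p‖ ^ 2 - 1) z ∈ Metric.ball (0 : E) 1 := by
  have hzp := ne_of_mem_ball_of_one_lt_norm hp hz
  have h := one_sub_norm_sphereInversion_sq hzp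
  have h1 : 0 < ‖z - p‖ ^ 2 := pow_pos (norm_pos_iff.2 (sub_ne_zero.2 hzp)) 2
  have h2 : 0 < ‖p‖ ^ 2 - 1 := by nlinarith
  have h3 : ‖z‖ < 1 := by simpa using hz
  have h4 : 0 < 1 - ‖z‖ ^ 2 := by nlinarith [norm_nonneg z]
  have h5 : 0 < (‖p‖ ^ 2 - 1) / ‖z - p‖ ^ 2 * (1 - ‖z‖ ^ 2) := by positivity
  simp only [Metric.mem_ball, dist_zero_right]
  nlinarith [norm_nonneg (sphereInversion p (‖p‖ ^ 2 - 1) z)]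

theorem kelvinTransform_pos {f : E → ℝ} (hpos : ∀ x ∈ Metric.ball (0 : E) 1, 0 < f x) {p : E}
    (hp : 1 < ‖p‖) {z : E} (hz : z ∈ Metric.ball (0 : E) 1) :
    0 < kelvinTransform p (‖p‖ ^ 2 - 1) f z := by
  have hzp := ne_of_mem_ball_of_one_lt_norm hp hz
  exact mul_pos (Real.rpow_pos_of_pos (pow_pos (norm_pos_iff.2 (sub_ne_zero.2 hzp)) 2) _)
    (hpos _ (sphereInversion_mem_ball hp hz))

/-- In the unit ball, `1 - |y|² ≤ [x, y] + |x - y|`. -/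
theorem one_sub_norm_sq_le_bracket_add_norm_sub {x y : E} (hy : ‖y‖ < 1) {B : ℝ}
    (hB0 : 0 < B) (hB : B ^ 2 = 1 + ‖y‖ ^ 2 * ‖x‖ ^ 2 - 2 * inner ℝ y x) :
    1 - ‖y‖ ^ 2 ≤ B + ‖x - y‖ := by
  -- Cauchy–Schwarz gives `B ^ 2 ≥ (1 - ‖y‖ * ‖x‖) ^ 2`. The rest is `1 - ‖y‖ ^ 2 = (1 - ‖y‖ * ‖x‖)
  -- + ‖y‖ * (‖x‖ - ‖y‖)`.
  have h1 : 1 - ‖y‖ * ‖x‖ ≤ B := by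
    refine le_of_sq_le_sq ?_ hB0.le
    nlinarith [real_inner_le_norm y x]
  have h2 : ‖x‖ - ‖y‖ ≤ ‖x - y‖ := norm_sub_norm_le x y
  have h3 := norm_nonneg (x - y)
  have h4 := norm_nonneg y
  rcases le_total ‖x‖ ‖y‖ with h | h
  · nlinarith
  · nlinarith [mul_nonneg (sub_nonneg.2 h) (sub_nonneg.2 hy.le)]

variable [FiniteDimensional ℝ E]

theorem harmonicOnNhd_kelvinTransform {f : E → ℝ} (hf : HarmonicOnNhd f (Metric.ball 0 1)) {p : E}
    (hp : 1 < ‖p‖) : HarmonicOnNhd (kelvinTransform p (‖p‖ ^ 2 - 1) f) (Metric.ball 0 1) :=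
  fun _ hz => (hf _ (sphereInversion_mem_ball hp hz)).kelvinTransform
    (ne_of_mem_ball_of_one_lt_norm hp hz)

variable [MeasurableSpace E] [BorelSpace E]

/-- The function `f (t • e) * (1 - t) ^ n` is at most `f 0` for `0 < t < 1` and equals it at `t =
0`, so its derivative there is nonpositive. -/
theorem hasDerivAt_line_le_finrank_mul {f : E → ℝ} (hf : HarmonicOnNhd f (Metric.ball 0 1))
    (hpos : ∀ x ∈ Metric.ball (0 : E) 1, 0 < f x) {e : E} (he : ‖e‖ = 1) {d : ℝ}
    (hd : HasDerivAt (fun t : ℝ => f (t • e)) d 0) : d ≤ Module.finrank ℝ E * f 0 := by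
  have h1 : HasDerivAt (fun t : ℝ => f (t • e) * (1 - t) ^ Module.finrank ℝ E)
      (d - Module.finrank ℝ E * f 0) 0 := by
    have h2 := hd.mul ((((hasDerivAt_id (0 : ℝ)).const_sub 1)).pow (Module.finrank ℝ E))
    refine h2.congr_deriv ?_
    simp
    ring
  have h3 := h1.hasDerivWithinAt (s := Set.Ioi 0)
  rw [hasDerivWithinAt_iff_tendsto_slope' (by simp)] at h3
  have h4 : d - Module.finrank ℝ E * f 0 ≤ 0 := by
    refine le_of_tendsto h3 ?_
    filter_upwards [Ioo_mem_nhdsGT (show (0 : ℝ) < 1 by norm_num)] with t ht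
    have hn : ‖t • e‖ = t := by rw [norm_smul, he, mul_one, Real.norm_of_nonneg ht.1.le]
    have h5 := harmonic_mul_one_sub_norm_pow_le hf hpos (x := t • e) (by simp [hn, ht.2])
    rw [hn] at h5
    rw [slope_def_field]
    refine div_nonpos_of_nonpos_of_nonneg ?_ (by linarith [ht.1])
    simpa using h5
  linarith

/-- The sharp upper bound for the logarithmic radial derivative of a positive harmonic function. -/
theorem one_sub_sq_mul_radial_deriv_le {f : E → ℝ} (hf : HarmonicOnNhd f (Metric.ball 0 1))
    (hpos : ∀ x ∈ Metric.ball (0 : E) 1, 0 < f x) {e : E} (he : ‖e‖ = 1) {t : ℝ} (ht0 : 0 < t)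
    (ht1 : t < 1) {d : ℝ} (hd : HasDerivAt (fun t : ℝ => f (t • e)) d t) :
    (1 - t ^ 2) * d ≤ (Module.finrank ℝ E + (Module.finrank ℝ E - 2) * t) * f (t • e) := by
  set n : ℝ := (Module.finrank ℝ E : ℝ) with hn
  -- Inversion about this `p` exchanges `0` and `t • e` and reverses the ray, hence the direction
  -- `-e` below. On the ray it acts as `s ↦ (t + s) / (1 + t * s)`, with derivative `1 - t ^ 2` at
  -- `0`; the weight contributes `(2 - n) * t`.
  set p : E := t⁻¹ • e with hp
  have hpn : ‖p‖ = t⁻¹ := by rw [hp, norm_smul, he, mul_one, Real.norm_of_nonneg (by positivity)]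
  have hp1 : 1 < ‖p‖ := by rw [hpn]; exact (one_lt_inv₀ ht0).2 ht1
  have hline : ∀ s : ℝ, 0 < 1 + t * s → kelvinTransform p (‖p‖ ^ 2 - 1) f (s • -e) =
      ((t⁻¹ + s) ^ 2) ^ (1 - n / 2) * f (((t + s) / (1 + t * s)) • e) := by
    intro s hs
    have h1 : s • -e - p = -((t⁻¹ + s) • e) := by rw [hp]; module
    have h2 : ‖s • -e - p‖ ^ 2 = (t⁻¹ + s) ^ 2 := by
      rw [h1, norm_neg, norm_smul, he, mul_one, Real.norm_eq_abs, sq_abs]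
    have h3 : t⁻¹ + s ≠ 0 := by
      have : t⁻¹ + s = (1 + t * s) / t := by field_simp
      rw [this]
      positivity
    rw [kelvinTransform, sphereInversion, h2, h1, hpn, hp]
    congr 2
    rw [← neg_smul, smul_smul, ← add_smul]
    congr 1
    have hs' := hs.ne'
    have h4 : t⁻¹ + s = (1 + t * s) / t := by field_simp
    rw [h4]
    field_simp
    ring
  have hg0 : kelvinTransform p (‖p‖ ^ 2 - 1) f 0 = ((t⁻¹) ^ 2) ^ (1 - n / 2) * f (t • e) := by
    simpa using hline 0 (by simp)
  have hmob : HasDerivAt (fun s : ℝ => (t + s) / (1 + t * s)) (1 - t ^ 2) 0 := by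
    have h := ((hasDerivAt_id (0 : ℝ)).const_add t).div
      (((hasDerivAt_id (0 : ℝ)).const_mul t).const_add 1) (by simp)
    refine h.congr_deriv ?_
    simp
    ring
  have hfm : HasDerivAt (fun s : ℝ => f (((t + s) / (1 + t * s)) • e)) (d * (1 - t ^ 2)) 0 :=
    HasDerivAt.comp_of_eq (0 : ℝ) hd hmob (by simp)
  have hw : HasDerivAt (fun s : ℝ => ((t⁻¹ + s) ^ 2) ^ (1 - n / 2))
      (((t⁻¹) ^ 2) ^ (1 - n / 2) * ((2 - n) * t)) 0 := by
    have h0 : (t⁻¹ + 0) ^ 2 ≠ 0 := by simp [ht0.ne']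
    have h := (((hasDerivAt_id (0 : ℝ)).const_add t⁻¹).pow 2).rpow_const (p := 1 - n / 2)
      (Or.inl h0)
    refine h.congr_deriv ?_
    rw [Real.rpow_sub_one (by simpa using h0)]
    simp
    field_simp
  have hder : HasDerivAt (fun s : ℝ => kelvinTransform p (‖p‖ ^ 2 - 1) f (s • -e))
      (((t⁻¹) ^ 2) ^ (1 - n / 2) * ((2 - n) * t * f (t • e) + (1 - t ^ 2) * d)) 0 := by
    have h := hw.mul hfm
    have hev : ∀ᶠ s in 𝓝 (0 : ℝ), 0 < 1 + t * s := by
      have : Filter.Tendsto (fun s : ℝ => 1 + t * s) (𝓝 0) (𝓝 1) := by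
        have h : Continuous fun s : ℝ => 1 + t * s := by fun_prop
        simpa using h.tendsto 0
      exact this.eventually (lt_mem_nhds one_pos)
    refine (h.congr_of_eventuallyEq (hev.mono fun s hs => hline s hs)).congr_deriv ?_
    simp
    ring
  have hle := hasDerivAt_line_le_finrank_mul (harmonicOnNhd_kelvinTransform hf hp1)
    (fun z hz => kelvinTransform_pos hpos hp1 hz) (by rwa [norm_neg]) hder
  rw [hg0, ← hn] at hle
  have hP : 0 < ((t⁻¹) ^ 2) ^ (1 - n / 2) := Real.rpow_pos_of_pos (by positivity) _
  have : (2 - n) * t * f (t • e) + (1 - t ^ 2) * d ≤ n * f (t • e) := by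
    refine le_of_mul_le_mul_left ?_ hP
    linarith
  linarith

/-- The sharp Harnack inequality from the centre of the unit ball. -/
theorem harmonic_mul_one_sub_norm_pow_le_mul_one_add_norm {f : E → ℝ} {m : ℕ}
    (hm : Module.finrank ℝ E = m + 2) (hf : HarmonicOnNhd f (Metric.ball 0 1))
    (hpos : ∀ x ∈ Metric.ball (0 : E) 1, 0 < f x) {x : E} (hx : x ∈ Metric.ball (0 : E) 1) :
    f x * (1 - ‖x‖) ^ (m + 1) ≤ f 0 * (1 + ‖x‖) := by
  rcases eq_or_ne x 0 with rfl | hx0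
  · simp
  have hxn : 0 < ‖x‖ := norm_pos_iff.2 hx0
  have hx1 : ‖x‖ < 1 := by simpa using hx
  set e : E := ‖x‖⁻¹ • x with he
  have hen : ‖e‖ = 1 := by rw [he, norm_smul, norm_inv, norm_norm, inv_mul_cancel₀ hxn.ne']
  have hxe : ‖x‖ • e = x := by rw [he, smul_smul, mul_inv_cancel₀ hxn.ne', one_smul]
  have hball : ∀ t ∈ Set.Icc 0 ‖x‖, t • e ∈ Metric.ball (0 : E) 1 := fun t ht => by
    simp only [Metric.mem_ball, dist_zero_right, norm_smul, hen, mul_one,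
      Real.norm_of_nonneg ht.1]
    linarith [ht.2]
  have hd : ∀ t ∈ Set.Icc 0 ‖x‖, HasDerivAt (fun t : ℝ => f (t • e)) (fderiv ℝ f (t • e) e) t :=
    fun t ht => by
      have h1 : HasDerivAt (fun s : ℝ => s • e) e t := by
        simpa using (hasDerivAt_id t).smul_const e
      exact ((hf _ (hball t ht)).1.differentiableAt (by norm_num)).hasFDerivAt.comp_hasDerivAt t h1
  -- The divisor `(1 + t) / (1 - t) ^ (m + 1)` solves the radial inequality with equality, since `(n
  -- + (n - 2) t) / (1 - t²) = (n - 1) / (1 - t) + 1 / (1 + t)`.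
  set F : ℝ → ℝ := fun t => f (t • e) * (1 - t) ^ (m + 1) / (1 + t) with hF
  have hFd : ∀ t ∈ Set.Icc 0 ‖x‖, HasDerivAt F
      (((fderiv ℝ f (t • e) e * (1 - t) ^ (m + 1) - f (t • e) * ((m + 1) * (1 - t) ^ m)) * (1 + t)
        - f (t • e) * (1 - t) ^ (m + 1)) / (1 + t) ^ 2) t := fun t ht => by
    have h := ((hd t ht).mul (((hasDerivAt_id t).const_sub 1).pow (m + 1))).div
      ((hasDerivAt_id t).const_add 1) (by simp only [id]; linarith [ht.1])
    refine h.congr_deriv ?_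
    simp
    ring
  have hanti : AntitoneOn F (Set.Icc 0 ‖x‖) := by
    refine antitoneOn_of_hasDerivWithinAt_nonpos (convex_Icc _ _)
      (fun t ht => (hFd t ht).continuousAt.continuousWithinAt)
      (fun t ht => (hFd t (interior_subset ht)).hasDerivWithinAt) fun t ht => ?_
    have ht' := interior_subset ht
    rw [interior_Icc] at ht
    have hb := one_sub_sq_mul_radial_deriv_le hf hpos hen ht.1 (ht.2.trans hx1) (hd t ht')
    rw [hm] at hb
    push_cast at hb
    refine div_nonpos_of_nonpos_of_nonneg ?_ (sq_nonneg _)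
    have h1 : 0 ≤ (1 - t) ^ m := pow_nonneg (by linarith [ht.2]) m
    have h2 := mul_le_mul_of_nonneg_left hb h1
    rw [pow_succ]
    linarith
  have h := hanti ⟨le_rfl, hxn.le⟩ ⟨hxn.le, le_rfl⟩ hxn.le
  simp only [hF, hxe, zero_smul, sub_zero, one_pow, mul_one, add_zero, div_one] at h
  rwa [div_le_iff₀ (by positivity)] at h

/-- The two-point Harnack inequality on the unit ball, in terms of `|x - y| / [x, y]`. -/
theorem harmonic_mul_one_sub_pow_le_mul_one_add_pow {f : E → ℝ} {m : ℕ}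
    (hm : Module.finrank ℝ E = m + 2) (hf : HarmonicOnNhd f (Metric.ball 0 1))
    (hpos : ∀ x ∈ Metric.ball (0 : E) 1, 0 < f x) {x y : E} (hx : x ∈ Metric.ball (0 : E) 1)
    (hy : y ∈ Metric.ball (0 : E) 1) {B : ℝ}
    (hB0 : 0 < B) (hB : B ^ 2 = 1 + ‖y‖ ^ 2 * ‖x‖ ^ 2 - 2 * inner ℝ y x) :
    f x * (1 - ‖x - y‖ / B) ^ (m + 1) ≤ f y * (1 + ‖x - y‖ / B) ^ (m + 1) := by
  have hx1 : ‖x‖ < 1 := by simpa using hx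
  have hy1 : ‖y‖ < 1 := by simpa using hy
  rcases eq_or_ne y 0 with rfl | hy0
  · have hB1 : B = 1 := by
      have : B ^ 2 = 1 := by simpa using hB
      nlinarith
    rw [hB1, div_one, sub_zero]
    refine (harmonic_mul_one_sub_norm_pow_le_mul_one_add_norm hm hf hpos hx).trans ?_
    refine mul_le_mul_of_nonneg_left ?_ (hpos 0 hy).le
    exact le_self_pow₀ (by linarith [norm_nonneg x]) (by omega)
  have hs : 0 < ‖y‖ := norm_pos_iff.2 hy0
  have hks : 0 < 1 - ‖y‖ ^ 2 := by nlinarith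
  -- The mirror image of `y` in the unit sphere: inversion about it exchanges `0` and `y` and sends
  -- `x` to a point of norm `‖x - y‖ / B`. The case `y = 0` had to be split off because it has no
  -- such image.
  set p : E := (‖y‖ ^ 2)⁻¹ • y with hp
  have hpn : ‖p‖ = ‖y‖⁻¹ := by
    rw [hp, norm_smul, norm_inv, norm_pow, norm_norm]
    field_simp
  have hp1 : 1 < ‖p‖ := by rw [hpn]; exact (one_lt_inv₀ hs).2 hy1
  set k : ℝ := ‖p‖ ^ 2 - 1 with hk
  have hky : k = (1 - ‖y‖ ^ 2) / ‖y‖ ^ 2 := by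
    rw [hk, hpn]
    field_simp
  have hk0 : k ≠ 0 := by rw [hky]; positivity
  have hxp := ne_of_mem_ball_of_one_lt_norm hp1 hx
  have hδ : ‖x - y‖ ^ 2 = ‖x‖ ^ 2 - 2 * inner ℝ y x + ‖y‖ ^ 2 := by
    rw [norm_sub_sq_real, real_inner_comm]
  have hxpn : ‖x - p‖ ^ 2 = B ^ 2 / ‖y‖ ^ 2 := by
    rw [norm_sub_sq_real, hpn, hp, inner_smul_right, real_inner_comm, hB]
    field_simp
    ring
  set z := sphereInversion p k x with hz
  have hzball : z ∈ Metric.ball (0 : E) 1 := sphereInversion_mem_ball hp1 hx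
  have hzn : ‖z‖ = ‖x - y‖ / B := by
    have h1 := one_sub_norm_sphereInversion_sq hxp
    rw [← hk, ← hz, hxpn, hky] at h1
    refine (pow_left_inj₀ (norm_nonneg z) (by positivity) two_ne_zero).1 ?_
    have h2 : ‖z‖ ^ 2 = 1 - (1 - ‖y‖ ^ 2) * (1 - ‖x‖ ^ 2) / B ^ 2 := by
      have h3 : (1 - ‖y‖ ^ 2) / ‖y‖ ^ 2 / (B ^ 2 / ‖y‖ ^ 2) * (1 - ‖x‖ ^ 2) =
          (1 - ‖y‖ ^ 2) * (1 - ‖x‖ ^ 2) / B ^ 2 := by field_simp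
      linarith
    rw [h2, div_pow, hδ]
    field_simp
    rw [hB]
    ring
  have h0y : sphereInversion p k 0 = y := by
    rw [sphereInversion, zero_sub, norm_neg, hpn, hky, hp, smul_neg, smul_smul, ← neg_smul,
      ← add_smul]
    have h : (‖y‖ ^ 2)⁻¹ + -((1 - ‖y‖ ^ 2) / ‖y‖ ^ 2 / ‖y‖⁻¹ ^ 2 * (‖y‖ ^ 2)⁻¹) = 1 := by
      field_simp
      ring
    rw [h, one_smul]
  have hH := harmonic_mul_one_sub_norm_pow_le_mul_one_add_norm hm
    (harmonicOnNhd_kelvinTransform hf hp1) (fun w hw => kelvinTransform_pos hpos hp1 hw) hzball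
  rw [← hk, kelvinTransform, kelvinTransform, hz, norm_sphereInversion_sub_sq,
    sphereInversion_sphereInversion hk0 hxp, ← hz, h0y, hxpn, zero_sub, norm_neg, hpn, hzn,
    hky, hm] at hH
  set ρ := ‖x - y‖ / B with hρ
  set q := (1 - ‖y‖ ^ 2) / B with hq
  have hq0 : 0 < q := by positivity
  have hfac : ((1 - ‖y‖ ^ 2) / ‖y‖ ^ 2) ^ 2 / (B ^ 2 / ‖y‖ ^ 2) = ‖y‖⁻¹ ^ 2 * q ^ 2 := by
    rw [hq]
    field_simp
  -- The Kelvin weight at `z` relative to that at `0` is `q ^ (2 - n) = q ^ (-m)`.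
  have hqc : (q ^ 2) ^ (1 - ((m + 2 : ℕ) : ℝ) / 2) = (q ^ m)⁻¹ := by
    rw [← Real.rpow_natCast q 2, ← Real.rpow_mul hq0.le, ← Real.rpow_natCast q m,
      ← Real.rpow_neg hq0.le]
    congr 1
    push_cast
    ring
  rw [hfac, Real.mul_rpow (by positivity) (by positivity), hqc] at hH
  have hP : 0 < (‖y‖⁻¹ ^ 2) ^ (1 - ((m + 2 : ℕ) : ℝ) / 2) := Real.rpow_pos_of_pos (by positivity) _
  have hH2 : (q ^ m)⁻¹ * (f x * (1 - ρ) ^ (m + 1)) ≤ f y * (1 + ρ) := by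
    refine le_of_mul_le_mul_left ?_ hP
    linarith
  rw [inv_mul_le_iff₀ (by positivity)] at hH2
  refine hH2.trans ?_
  -- The bound is exact in `q` up to here; estimating `q ^ m` by `(1 + ρ) ^ m` leaves an expression
  -- in `ρ` alone.
  have hqρ : q ≤ 1 + ρ := by
    rw [hq, hρ, div_le_iff₀ hB0, add_mul, div_mul_cancel₀ _ hB0.ne', one_mul]
    exact one_sub_norm_sq_le_bracket_add_norm_sub hy1 hB0 hB
  have h1 : q ^ m ≤ (1 + ρ) ^ m := pow_le_pow_left₀ hq0.le hqρ m
  have h2 : 0 ≤ f y * (1 + ρ) := mul_nonneg (hpos y hy).le (by positivity)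
  calc q ^ m * (f y * (1 + ρ)) ≤ (1 + ρ) ^ m * (f y * (1 + ρ)) := mul_le_mul_of_nonneg_right h1 h2
    _ = f y * (1 + ρ) ^ (m + 1) := by ring

end BallHarnack

/-! ### Translation to the hyperbolic metric -/

section HyperbolicBall

variable {n : ℕ}

/-- Shows that the radicand of the bracket is positive in the ball and exceeds `‖x - y‖ ^ 2`, so
that `|φ_y(x)| < 1`. -/
theorem one_sub_mul_one_sub_add_norm_sub_sq (x y : EuclideanSpace ℝ (Fin n)) :
    1 + ‖y‖ ^ 2 * ‖x‖ ^ 2 - 2 * inner ℝ y x =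
      (1 - ‖y‖ ^ 2) * (1 - ‖x‖ ^ 2) + ‖x - y‖ ^ 2 := by
  rw [norm_sub_sq_real, real_inner_comm]
  ring

theorem ballBracket_sq_eq {x y : EuclideanSpace ℝ (Fin n)} (hx : ‖x‖ < 1) (hy : ‖y‖ < 1) :
    ballBracket x y ^ 2 = 1 + ‖y‖ ^ 2 * ‖x‖ ^ 2 - 2 * inner ℝ y x := by
  refine Real.sq_sqrt ?_
  rw [one_sub_mul_one_sub_add_norm_sub_sq]
  have h1 : 0 ≤ 1 - ‖y‖ ^ 2 := by nlinarith [norm_nonneg y]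
  have h2 : 0 ≤ 1 - ‖x‖ ^ 2 := by nlinarith [norm_nonneg x]
  positivity

theorem norm_sub_lt_ballBracket {x y : EuclideanSpace ℝ (Fin n)} (hx : ‖x‖ < 1) (hy : ‖y‖ < 1) :
    ‖x - y‖ < ballBracket x y := by
  refine Real.lt_sqrt_of_sq_lt ?_
  rw [one_sub_mul_one_sub_add_norm_sub_sq]
  have h1 : 0 < 1 - ‖y‖ ^ 2 := by nlinarith [norm_nonneg y]
  have h2 : 0 < 1 - ‖x‖ ^ 2 := by nlinarith [norm_nonneg x]
  nlinarith [mul_pos h1 h2]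

theorem ballBracket_comm (x y : EuclideanSpace ℝ (Fin n)) : ballBracket x y = ballBracket y x := by
  rw [ballBracket, ballBracket, real_inner_comm, mul_comm (‖y‖ ^ 2)]

/-- The squared norm of the numerator factors as `|x - y|² [x, y]²`. The resulting ratio is
symmetric in `x` and `y`, which makes the distance symmetric. -/
theorem norm_ballMobius {x y : EuclideanSpace ℝ (Fin n)} (hx : ‖x‖ < 1) (hy : ‖y‖ < 1) :
    ‖ballMobius y x‖ = ‖x - y‖ / ballBracket x y := by
  have hB : 0 < ballBracket x y := (norm_nonneg _).trans_lt (norm_sub_lt_ballBracket hx hy)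
  refine (pow_left_inj₀ (norm_nonneg _) (by positivity) two_ne_zero).1 ?_
  have h1 : ‖(1 - ‖y‖ ^ 2) • (y - x) + ‖y - x‖ ^ 2 • y‖ ^ 2 =
      ‖x - y‖ ^ 2 * ballBracket x y ^ 2 := by
    rw [ballBracket_sq_eq hx hy, norm_add_sq_real, norm_smul, norm_smul, inner_smul_left,
      inner_smul_right, inner_sub_left, real_inner_self_eq_norm_sq, real_inner_comm y x, mul_pow,
      mul_pow, Real.norm_eq_abs, Real.norm_eq_abs, sq_abs, sq_abs, norm_sub_rev y x,
      norm_sub_sq_real, real_inner_comm y x]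
    simp
    ring
  rw [ballMobius, norm_smul, mul_pow, h1, div_pow, Real.norm_eq_abs, sq_abs]
  field_simp

theorem ballHypDist_comm {x y : EuclideanSpace ℝ (Fin n)} (hx : ‖x‖ < 1) (hy : ‖y‖ < 1) :
    ballHypDist x y = ballHypDist y x := by
  rw [ballHypDist, ballHypDist, norm_ballMobius hx hy, norm_ballMobius hy hx, ballBracket_comm,
    norm_sub_rev]

theorem log_harmonic_sub_log_harmonic_le (hn : 2 ≤ n) {f : EuclideanSpace ℝ (Fin n) → ℝ}
    (hf : HarmonicOnNhd f (Metric.ball 0 1))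
    (hpos : ∀ x ∈ Metric.ball (0 : EuclideanSpace ℝ (Fin n)) 1, 0 < f x)
    {x y : EuclideanSpace ℝ (Fin n)} (hx : x ∈ Metric.ball (0 : EuclideanSpace ℝ (Fin n)) 1)
    (hy : y ∈ Metric.ball (0 : EuclideanSpace ℝ (Fin n)) 1) :
    Real.log (f x) - Real.log (f y) ≤ ((n : ℝ) - 1) * ballHypDist x y := by
  obtain ⟨m, rfl⟩ := Nat.exists_eq_add_of_le' hn
  have hx1 : ‖x‖ < 1 := by simpa using hx
  have hy1 : ‖y‖ < 1 := by simpa using hy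
  have hlt := norm_sub_lt_ballBracket hx1 hy1
  have hB : 0 < ballBracket x y := (norm_nonneg _).trans_lt hlt
  have h := harmonic_mul_one_sub_pow_le_mul_one_add_pow (m := m) (by simp) hf hpos hx hy hB
    (ballBracket_sq_eq hx1 hy1)
  rw [ballHypDist, norm_ballMobius hx1 hy1]
  set ρ := ‖x - y‖ / ballBracket x y with hρ
  have hρ0 : 0 ≤ ρ := by positivity
  have hρ1 : ρ < 1 := (div_lt_one hB).2 hlt
  have h1 : 0 < 1 - ρ := by linarith
  have h2 : 0 < 1 + ρ := by linarith
  have hfx := hpos x hx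
  have hfy := hpos y hy
  have h3 := Real.log_le_log (by positivity) h
  rw [Real.log_mul hfx.ne' (by positivity), Real.log_mul hfy.ne' (by positivity), Real.log_pow,
    Real.log_pow] at h3
  -- `2 artanh ρ = log (1 + ρ) - log (1 - ρ)`, and the exponent `m + 1` is `n - 1`.
  rw [Real.artanh_eq_half_log ⟨by linarith, hρ1.le⟩, Real.log_div h2.ne' h1.ne']
  push_cast at h3 ⊢
  linarith

end HyperbolicBall

end

theorem mainTheorem1 (n : ℕ) (hn : 2 ≤ n) (f : EuclideanSpace ℝ (Fin n) → ℝ)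
    (hf : InnerProductSpace.HarmonicOnNhd f (Metric.ball 0 1))
    (hpos : ∀ x ∈ Metric.ball (0 : EuclideanSpace ℝ (Fin n)) 1, 0 < f x)
    (x y : EuclideanSpace ℝ (Fin n))
    (hx : x ∈ Metric.ball (0 : EuclideanSpace ℝ (Fin n)) 1)
    (hy : y ∈ Metric.ball (0 : EuclideanSpace ℝ (Fin n)) 1) :
    posHypDist (f x) (f y) ≤ ((n : ℝ) - 1) * ballHypDist x y := by
  rw [posHypDist, Real.log_div (hpos x hx).ne' (hpos y hy).ne', abs_le']
  refine ⟨log_harmonic_sub_log_harmonic_le hn hf hpos hx hy, ?_⟩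
  rw [neg_sub, ballHypDist_comm (by simpa using hx) (by simpa using hy)]
  exact log_harmonic_sub_log_harmonic_le hn hf hpos hy hx
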